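/- **Proposition 5.1.** Let $\beta>0$, $\sigma>0$, and let $z=(z_1,z_2)\in\mathbb R^2$ satisfy $z_1<-\sigma$ and $z_2=0$. Define $$\psi(s)=\begin{cases}\exp\left(-\frac{1}{1-s^2}\right) & \text{if } |s|<1,\\ 0 & \text{if } |s|\ge 1,\end{cases}\qquad \tilde\psi(y)=\psi\left(\frac{|y-z|}{\sigma}\right)\quad (y\in\mathbb R^2),$$ and, for $\gamma\ge 0$, the running cost $$\ell_\gamma(y)=\tfrac12|y|^2\left(1+\gamma\,\tilde\psi(y)\right).$$ Let $$\gamma_s=\frac{1}{\sup_{y\in B(z,\sigma)}\left\{2|y|\,|\nabla\tilde\psi(y)|+\frac12|y|^2\,|\nabla^2\tilde\psi(y)|\right\}},$$ where $B(z,\sigma)$ is the disc of center $z$ and radius $\sigma$, $|\cdot|$ is the Euclidean norm for vectors and the operator (spectral) norm for matrices. For $y_0\in\mathbb R^2$ let $$V_\gamma(y_0)=\inf\left\{\int_0^\infty \ell_\gamma(y(t))\,dt+\frac{\beta}{2}\int_0^\infty|u(t)|^2\,dt\;:\; u\in L^2((0,\infty);\mathbb R^2),\ y'=u,\ y(0)=y_0\right\}.$$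 If $\gamma\in[0,\gamma_s)$, then for every $y_0\in\mathbb R^2$ this infimum is finite and attained (so it is a minimum), and the value function $V_\gamma$ belongs to $C^\infty(\mathbb R^2)$. -/

import Mathlib

open MeasureTheory Set
open scoped ContDiff Gradient

noncomputable section

namespace ObstacleControl

/-- The plane `ℝ²` with its Euclidean norm. -/
abbrev Plane : Type := EuclideanSpace ℝ (Fin 2)

/-- The standard bump profile: `exp (-1 / (1 - s²))` for `|s| < 1`, and `0` for `|s| ≥ 1`. -/
def bump (s : ℝ) : ℝ :=
  if |s| < 1 then Real.exp (-(1 / (1 - s ^ 2))) else 0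

/-- The obstacle profile with center `z` and radius `σ`: `y ↦ bump (|y - z| / σ)`. -/
def obstacle (z : Plane) (σ : ℝ) (y : Plane) : ℝ :=
  bump (‖y - z‖ / σ)

/-- The running cost `½ |y|² (1 + γ * bump (|y - z| / σ))`. -/
def runningCost (γ : ℝ) (z : Plane) (σ : ℝ) (y : Plane) : ℝ :=
  1 / 2 * ‖y‖ ^ 2 * (1 + γ * obstacle z σ y)

/-- The function `2 |y| |∇φ(y)| + ½ |y|² |∇²φ(y)|`, where `φ` is the obstacle profile. The Hessian
`∇²φ(y)` is the derivative of the gradient field, and its norm is the operator (spectral) norm. -/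
def curvatureBound (z : Plane) (σ : ℝ) (y : Plane) : ℝ :=
  2 * ‖y‖ * ‖∇ (obstacle z σ) y‖ + 1 / 2 * ‖y‖ ^ 2 * ‖fderiv ℝ (∇ (obstacle z σ)) y‖

/-- The threshold for the penalty parameter. The profile is smooth on the whole plane, so that the
supremum is one of a bounded function. -/
def gammaThreshold (z : Plane) (σ : ℝ) : ℝ :=
  1 / sSup (curvatureBound z σ '' Metric.ball z σ)

/-- Admissible controls: `u ∈ L²((0, ∞); ℝ²)`. -/
def Admissible (u : ℝ → Plane) : Prop :=
  MemLp u 2 (volume.restrict (Ioi (0 : ℝ)))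

/-- The solution on `[0, ∞)` of `y' = u`, `y(0) = y₀`: the absolutely continuous function
`t ↦ y₀ + ∫₀ᵗ u(s) ds`. -/
def trajectory (y₀ : Plane) (u : ℝ → Plane) (t : ℝ) : Plane :=
  y₀ + ∫ s in (0 : ℝ)..t, u s

/-- The objective `∫₀^∞ ℓ(y(t)) dt + (β / 2) ∫₀^∞ |u(t)|² dt`, with values in `[0, ∞]`
(the integrands are nonnegative for `γ ≥ 0`). -/
def cost (γ β : ℝ) (z : Plane) (σ : ℝ) (y₀ : Plane) (u : ℝ → Plane) : ENNReal :=
  (∫⁻ t in Ioi (0 : ℝ), ENNReal.ofReal (runningCost γ z σ (trajectory y₀ u t))) +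
    ENNReal.ofReal (β / 2) * ∫⁻ t in Ioi (0 : ℝ), ENNReal.ofReal (‖u t‖ ^ 2)

/-- The value function: the infimum of the objective over all admissible controls. -/
def valueFunction (γ β : ℝ) (z : Plane) (σ : ℝ) (y₀ : Plane) : ℝ :=
  (⨅ u : {u : ℝ → Plane // Admissible u}, cost γ β z σ y₀ u.1).toReal

end ObstacleControl

end

/-! Subtracting the reference path `e⁻ᵗ p` from the trajectory turns the control problem into an
unconstrained minimization over the fixed Hilbert space of functions `w ∈ H¹` with `w(0) = 0`, with
the initial state `p` as a parameter. This loses nothing: the running cost dominates `½ |y|²`, so a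
control of finite cost has a square integrable trajectory (`exists_velocity_of_cost_ne_top`,
`cost_eq_reducedCost`).

The reduced cost is strongly convex in `w`. The term `½ |y|²` times the obstacle profile has Hessian
at least `-S`, where `S` is the supremum in the threshold (`convexOn_obstacleCost_add`), so the
running cost keeps the modulus `1 - γ S > 0`, and the control term contributes `β`
(`strongConvexOn_reducedCost`).

It is also smooth in `(p, w)`. The quadratic terms are clear. The obstacle lies away from the origin
while `H¹` trajectories tend to `0`, so all trajectories near a given one avoid it after a common
time. The obstacle integral is then locally an integral over a bounded interval
(`contDiff_obstacleIntegral`).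

A smooth, uniformly convex family has a smooth minimum value, by the implicit function theorem
applied to the critical point equation (`exists_minimizer_contDiff_of_strongConvexOn`). -/

open scoped Topology

/-! ### Strongly convex functions on a Hilbert space and their minimum values. -/

section StrongConvexity

variable {H : Type*} [NormedAddCommGroup H] [InnerProductSpace ℝ H]

/-- The first-order characterization of strong convexity. -/
theorem StrongConvexOn.add_fderiv_add_le {f : H → ℝ} {c : ℝ} (hf : StrongConvexOn univ c f)
    {a : H} (hd : DifferentiableAt ℝ f a) (b : H) :
    f a + fderiv ℝ f a (b - a) + c / 2 * ‖b - a‖ ^ 2 ≤ f b := by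
  rw [strongConvexOn_iff_convex] at hf
  set g : H → ℝ := fun x => f x - c / 2 * ‖x‖ ^ 2 with hg
  -- Removing the quadratic leaves a convex function of one variable on the line through `a` and
  -- `b`, whose derivative at `0` is at most its slope over `[0, 1]`.
  have hline : ConvexOn ℝ univ (g ∘ (AffineMap.lineMap a b : ℝ → H)) :=
    hf.comp_affineMap (AffineMap.lineMap (k := ℝ) a b)
  have hl : HasDerivAt (AffineMap.lineMap a b : ℝ → H) (b - a) 0 := AffineMap.hasDerivAt_lineMap
  have hl0 : (AffineMap.lineMap a b : ℝ → H) 0 = a := by simp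
  have h1 : HasFDerivAt g (fderiv ℝ f a - (c / 2) • (2 • innerSL ℝ a)) a :=
    hd.hasFDerivAt.sub ((hasStrictFDerivAt_norm_sq a).hasFDerivAt.const_mul (c / 2))
  have h2 : HasDerivAt (g ∘ (AffineMap.lineMap a b : ℝ → H))
      ((fderiv ℝ f a - (c / 2) • (2 • innerSL ℝ a)) (b - a)) 0 := by
    refine HasFDerivAt.comp_hasDerivAt (𝕜 := ℝ) (0 : ℝ) ?_ hl
    rwa [hl0]
  have h3 := hline.le_slope_of_hasDerivAt (mem_univ 0) (mem_univ 1) zero_lt_one h2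
  have h4 : inner ℝ a (b - a) = inner ℝ a b - ‖a‖ ^ 2 := by
    rw [inner_sub_right, real_inner_self_eq_norm_sq]
  have h5 := norm_sub_sq_real b a
  rw [real_inner_comm] at h5
  simp [slope_def_field, hg, h4] at h3
  rw [h5, map_sub]
  linarith

variable [CompleteSpace H]

/-- Strong convexity at the midpoint makes every minimizing sequence Cauchy, so no weak compactness
is needed. -/
theorem StrongConvexOn.exists_isMinOn {f : H → ℝ} {c : ℝ} (hc : 0 < c)
    (hf : StrongConvexOn univ c f) (hcont : Continuous f) (hbdd : BddBelow (range f)) :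
    ∃ a, ∀ b, f a ≤ f b := by
  obtain ⟨-, hf'⟩ := hf
  set m := sInf (range f)
  have hle : ∀ b, m ≤ f b := fun b => csInf_le hbdd (mem_range_self b)
  have hex : ∀ n : ℕ, ∃ x, f x < m + 1 / ((n : ℝ) + 1) := fun n => by
    obtain ⟨_, ⟨x, rfl⟩, hx⟩ := exists_lt_of_csInf_lt (range_nonempty f)
      (lt_add_of_pos_right m (Nat.one_div_pos_of_nat (α := ℝ) (n := n)))
    exact ⟨x, hx⟩
  choose x hx using hex
  have hdist : ∀ a b, c / 8 * ‖a - b‖ ^ 2 ≤ (f a - m) / 2 + (f b - m) / 2 := fun a b => by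
    have h := hf' (mem_univ a) (mem_univ b) (a := 1 / 2) (b := 1 / 2)
      (by norm_num) (by norm_num) (by norm_num)
    have := hle ((1 / 2 : ℝ) • a + (1 / 2 : ℝ) • b)
    simp only [smul_eq_mul] at h
    linarith
  have hcau : CauchySeq x := by
    rw [Metric.cauchySeq_iff']
    intro ε hε
    obtain ⟨N, hN⟩ := exists_nat_one_div_lt (show 0 < c / 8 * ε ^ 2 by positivity)
    refine ⟨N, fun n hn => ?_⟩
    have h1 : 1 / ((n : ℝ) + 1) ≤ 1 / ((N : ℝ) + 1) := Nat.one_div_le_one_div hn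
    have h2 := hdist (x n) (x N)
    have h3 : c / 8 * ‖x n - x N‖ ^ 2 < c / 8 * ε ^ 2 := by linarith [hx n, hx N]
    rw [dist_eq_norm]
    exact lt_of_pow_lt_pow_left₀ 2 hε.le (lt_of_mul_lt_mul_left h3 (by positivity))
  obtain ⟨a, ha⟩ := cauchySeq_tendsto_of_complete hcau
  refine ⟨a, fun b => le_trans ?_ (hle b)⟩
  have hlim : Filter.Tendsto (fun n : ℕ => m + 1 / ((n : ℝ) + 1)) Filter.atTop (𝓝 (m + 0)) :=
    tendsto_const_nhds.add tendsto_one_div_add_atTop_nhds_zero_nat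
  rw [add_zero] at hlim
  exact le_of_tendsto_of_tendsto' ((hcont.tendsto a).comp ha) hlim fun n => (hx n).le

/-- A coercive bilinear form on a Hilbert space induces an isomorphism onto the dual. -/
theorem IsCoercive.isInvertible {B : H →L[ℝ] H →L[ℝ] ℝ} (hB : IsCoercive B) : B.IsInvertible := by
  obtain ⟨C, hC, hcoer⟩ := hB
  have hinj : Function.Injective B := by
    rw [injective_iff_map_eq_zero]
    intro v hv
    have := hcoer v
    rw [hv] at this
    by_contra hne
    have h0 : 0 < ‖v‖ := norm_pos_iff.2 hne
    have : 0 < C * ‖v‖ * ‖v‖ := by positivity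
    simp at *
    linarith
  have hsurj : Function.Surjective B := fun l => by
    refine ⟨(IsCoercive.continuousLinearEquivOfBilin ⟨C, hC, hcoer⟩).symm
      ((InnerProductSpace.toDual ℝ H).symm l), ?_⟩
    ext w
    rw [← IsCoercive.continuousLinearEquivOfBilin_apply ⟨C, hC, hcoer⟩]
    simp
  exact ⟨ContinuousLinearEquiv.ofBijective B (LinearMap.ker_eq_bot.2 hinj)
    (LinearMap.range_eq_top.2 hsurj), by ext; rfl⟩

/-- The minimum value of a smooth family of strongly convex functions depends smoothly on the
parameter. -/
theorem exists_minimizer_contDiff_of_strongConvexOn {P : Type*} [NormedAddCommGroup P]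
    [NormedSpace ℝ P] [CompleteSpace P] {Φ : P × H → ℝ} {c : ℝ} (hc : 0 < c)
    (hΦ : ContDiff ℝ ∞ Φ) (hconv : ∀ p, StrongConvexOn univ c fun x => Φ (p, x))
    (hbdd : ∀ p, BddBelow (range fun x => Φ (p, x))) :
    ∃ w : P → H, (∀ p x, Φ (p, w p) ≤ Φ (p, x)) ∧ ContDiff ℝ ∞ fun p => Φ (p, w p) := by
  have hmin : ∀ p, ∃ a, ∀ b, Φ (p, a) ≤ Φ (p, b) := fun p =>
    (hconv p).exists_isMinOn hc (hΦ.continuous.comp (by fun_prop)) (hbdd p)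
  choose w hw using hmin
  refine ⟨w, hw, ?_⟩
  set F : P × H → H →L[ℝ] ℝ := fun q => (fderiv ℝ Φ q).comp (.inr ℝ P H) with hF
  have hFsmooth : ContDiff ℝ ∞ F := (hΦ.fderiv_right le_rfl).clm_comp contDiff_const
  have hpart : ∀ p x, HasFDerivAt (fun x => Φ (p, x)) (F (p, x)) x := fun p x =>
    ((hΦ.differentiable (by simp)) (p, x)).hasFDerivAt.comp x (hasFDerivAt_prodMk_right p x)
  have hfirst : ∀ p a b, Φ (p, a) + F (p, a) (b - a) + c / 2 * ‖b - a‖ ^ 2 ≤ Φ (p, b) := by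
    intro p a b
    have := (hconv p).add_fderiv_add_le (hpart p a).differentiableAt b
    rwa [(hpart p a).fderiv] at this
  have hcrit : ∀ p, F (p, w p) = 0 := fun p =>
    IsLocalMin.hasFDerivAt_eq_zero (Filter.Eventually.of_forall (hw p)) (hpart p (w p))
  -- Adding the first-order inequality in both directions gives strong monotonicity of the partial
  -- derivative; its difference quotients then yield coercivity of the partial Hessian `B`.
  have hmono : ∀ p a v, c * ‖v‖ ^ 2 ≤ (F (p, a + v) - F (p, a)) v := by
    intro p a v
    have h1 := hfirst p a (a + v)
    have h2 := hfirst p (a + v) a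
    simp only [add_sub_cancel_left, sub_add_cancel_left, norm_neg, map_neg] at h1 h2
    rw [_root_.sub_apply]
    linarith
  rw [contDiff_iff_contDiffAt]
  intro p
  have hFd := (hFsmooth.differentiable (by simp) (p, w p)).hasFDerivAt
  set B : H →L[ℝ] H →L[ℝ] ℝ := (fderiv ℝ F (p, w p)).comp (.inr ℝ P H) with hBdef
  have hB : HasFDerivAt (fun x => F (p, x)) B (w p) := hFd.comp (w p) (hasFDerivAt_prodMk_right p _)
  have hcoer : IsCoercive B := by
    refine ⟨c, hc, fun v => ?_⟩
    have hl := (hB.hasLineDerivAt v).tendsto_slope_zero_right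
    have hl2 := ((ContinuousLinearMap.apply ℝ ℝ v).continuous.tendsto _).comp hl
    refine ge_of_tendsto hl2 ?_
    filter_upwards [self_mem_nhdsWithin] with t ht
    have ht : 0 < t := ht
    have := hmono p (w p) (t • v)
    simp only [map_smul, norm_smul, Real.norm_eq_abs, mul_pow, sq_abs, smul_eq_mul] at this
    simp only [Function.comp_apply, ContinuousLinearMap.apply_apply,
      _root_.smul_apply, smul_eq_mul]
    rw [← sub_nonneg]
    have h3 : 0 ≤ t⁻¹ * t⁻¹ * (t * (F (p, w p + t • v) - F (p, w p)) v - c * (t ^ 2 * ‖v‖ ^ 2)) :=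
      mul_nonneg (by positivity) (by linarith)
    refine h3.trans_eq ?_
    field_simp
  have hinv : (fderiv ℝ F (p, w p) ∘L .inr ℝ P H).IsInvertible := hcoer.isInvertible
  have hFat : ContDiffAt ℝ ∞ F (p, w p) := hFsmooth.contDiffAt
  have hψ := hFat.contDiffAt_implicitFunction (by simp) hinv
  have hψeq := hFat.eventually_apply_implicitFunction (by simp) hinv
  set ψ := hFat.implicitFunction (by simp) hinv
  -- By convexity each critical point `ψ p'` is a global minimizer, so the two values agree. No
  -- continuity of the chosen `w` is required.
  have hev : (fun p => Φ (p, w p)) =ᶠ[𝓝 p] fun p => Φ (p, ψ p) := by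
    filter_upwards [hψeq] with p' hp'
    refine le_antisymm (hw p' _) ?_
    have := hfirst p' (ψ p') (w p')
    rw [hp', hcrit] at this
    have h0 : 0 ≤ c / 2 * ‖w p' - ψ p'‖ ^ 2 := by positivity
    simp only [_root_.zero_apply] at this
    linarith
  exact ContDiffAt.congr_of_eventuallyEq
    (hΦ.contDiffAt.comp p (contDiffAt_id.prodMk hψ)) hev

end StrongConvexity

/-! ### Smooth dependence of integrals over bounded intervals. -/

section ParametricIntegral

universe u

variable {E G : Type u} [NormedAddCommGroup E] [NormedSpace ℝ E] [NormedAddCommGroup G]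
  [NormedSpace ℝ G]

theorem hasFDerivAt_integral_of_continuous {F : Type*} [NormedAddCommGroup F] [NormedSpace ℝ F]
    {f : E → ℝ → F} {f' : E → ℝ → E →L[ℝ] F} (hf : Continuous f.uncurry)
    (hf' : Continuous f'.uncurry) (hd : ∀ x t, HasFDerivAt (fun x => f x t) (f' x t) x)
    (T : ℝ) (x : E) :
    HasFDerivAt (fun x => ∫ t in (0 : ℝ)..T, f x t) (∫ t in (0 : ℝ)..T, f' x t) x := by
  have hslice : ∀ x, Continuous (f x) := fun x => hf.comp (Continuous.prodMk_right x)
  have hslice' : ∀ x, Continuous (f' x) := fun x => hf'.comp (Continuous.prodMk_right x)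
  -- Compactness of the interval gives one neighbourhood of `x` valid for all `t`, hence a
  -- dominating function.
  have hev : ∀ᶠ x' in 𝓝 x, ∀ t ∈ uIcc 0 T, ‖f' x' t‖ < ‖f' x t‖ + 1 := by
    refine isCompact_uIcc.eventually_forall_of_forall_eventually fun t _ => ?_
    have h1 : Continuous fun q : E × ℝ => ‖f' q.1 q.2‖ := hf'.norm
    have h2 : Continuous fun q : E × ℝ => ‖f' x q.2‖ + 1 := by
      have := hslice' x
      fun_prop
    exact h1.continuousAt.eventually_lt h2.continuousAt (by simp)
  refine intervalIntegral.hasFDerivAt_integral_of_dominated_of_fderiv_le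
    (bound := fun t => ‖f' x t‖ + 1) hev ?_ ((hslice x).intervalIntegrable _ _)
    (hslice' x).aestronglyMeasurable ?_ ?_ ?_
  · exact Filter.Eventually.of_forall fun x => (hslice x).aestronglyMeasurable
  · exact Filter.Eventually.of_forall fun t ht x' hx' => (hx' t (uIoc_subset_uIcc ht)).le
  · exact Continuous.intervalIntegrable (by have := hslice' x; fun_prop) _ _
  · exact Filter.Eventually.of_forall fun t _ x' _ => hd x' t

/-- The outer family `M` closes this class of integrands under differentiation: the derivative of `M
t (h (A t x))` is `M t ∘ Dh (A t x) ∘ A t`, again a continuous family of linear maps applied to a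
smooth function of `A t x`. Induction on the order therefore runs over all target spaces. -/
theorem contDiff_integral_clm_apply_comp_clm {A : ℝ → E →L[ℝ] G} (hA : Continuous A) (T : ℝ)
    (n : ℕ) : ∀ {F F' : Type u} [NormedAddCommGroup F] [NormedSpace ℝ F] [NormedAddCommGroup F']
    [NormedSpace ℝ F'] {h : G → F} (_ : ContDiff ℝ ∞ h) {M : ℝ → F →L[ℝ] F'} (_ : Continuous M),
    ContDiff ℝ n fun x => ∫ t in (0 : ℝ)..T, M t (h (A t x)) := by
  induction n with
  | zero =>
    intro F F' _ _ _ _ h hh M hM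
    refine contDiff_zero.2 ?_
    have := hh.continuous
    refine intervalIntegral.continuous_parametric_intervalIntegral_of_continuous'
      (f := fun x t => M t (h (A t x))) ?_ _ _
    simp only [Function.uncurry_def]
    fun_prop
  | succ n ih =>
    intro F F' _ _ _ _ h hh M hM
    have hh1 := hh.continuous
    have hh2 : ContDiff ℝ ∞ (fderiv ℝ h) := hh.fderiv_right le_rfl
    have hh3 := hh2.continuous
    set M' : ℝ → (G →L[ℝ] F) →L[ℝ] (E →L[ℝ] F') := fun t =>
      (ContinuousLinearMap.compL ℝ E F F' (M t)).comp
        ((ContinuousLinearMap.compL ℝ E G F).flip (A t)) with hM'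
    have hM'c : Continuous M' := by fun_prop
    refine contDiff_succ_iff_hasFDerivAt.2
      ⟨fun x => ∫ t in (0 : ℝ)..T, M' t (fderiv ℝ h (A t x)), ih hh2 hM'c, fun x => ?_⟩
    refine hasFDerivAt_integral_of_continuous (f := fun x t => M t (h (A t x)))
      (f' := fun x t => M' t (fderiv ℝ h (A t x))) ?_ ?_ ?_ T x
    · simp only [Function.uncurry_def]
      fun_prop
    · simp only [Function.uncurry_def]
      fun_prop
    · intro x t
      exact (M t).hasFDerivAt.comp x
        (((hh.differentiable (by simp)) (A t x)).hasFDerivAt.comp x (A t).hasFDerivAt)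

/-- Smoothness of `x ↦ ∫ h(A(t) x) dt` over a bounded interval, for a norm-continuous family `A` of
continuous linear maps. -/
theorem contDiff_integral_comp_clm {A : ℝ → E →L[ℝ] G} (hA : Continuous A) (T : ℝ)
    {F : Type u} [NormedAddCommGroup F] [NormedSpace ℝ F] {h : G → F} (hh : ContDiff ℝ ∞ h) :
    ContDiff ℝ ∞ fun x => ∫ t in (0 : ℝ)..T, h (A t x) :=
  contDiff_infty.2 fun n => by
    simpa using contDiff_integral_clm_apply_comp_clm hA T n hh
      (M := fun _ => ContinuousLinearMap.id ℝ F) continuous_const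

end ParametricIntegral

theorem convexOn_univ_of_forall_line {E : Type*} [AddCommGroup E] [Module ℝ E] {g : E → ℝ}
    (hg : ∀ a v : E, ConvexOn ℝ univ fun s : ℝ => g (a + s • v)) : ConvexOn ℝ univ g := by
  refine ⟨convex_univ, fun x _ y _ a b ha hb hab => ?_⟩
  have h := (hg x (y - x)).2 (mem_univ 0) (mem_univ 1) ha hb hab
  have h1 : x + b • (y - x) = a • x + b • y := by
    rw [← eq_sub_iff_add_eq] at hab
    subst hab
    module
  simpa [h1] using h

/-! ### Smoothness and semiconvexity of the obstacle cost. -/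

namespace ObstacleControl

variable {z : Plane} {σ : ℝ}

theorem bump_eq_expNegInvGlue (s : ℝ) : bump s = expNegInvGlue (1 - s ^ 2) := by
  have : |s| < 1 ↔ ¬ 1 - s ^ 2 ≤ 0 := by rw [← sq_lt_one_iff_abs_lt_one]; constructor <;> grind
  unfold bump expNegInvGlue
  by_cases h : |s| < 1
  · rw [if_pos h, if_neg (this.1 h), one_div]
  · rw [if_neg h, if_pos (by tauto)]

theorem obstacle_contDiff (z : Plane) (σ : ℝ) : ContDiff ℝ ∞ (obstacle z σ) := by
  have : obstacle z σ = fun y => expNegInvGlue (1 - ‖y - z‖ ^ 2 / σ ^ 2) := by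
    ext y
    rw [obstacle, bump_eq_expNegInvGlue, div_pow]
  rw [this]
  refine (expNegInvGlue.contDiff (n := ⊤)).comp (contDiff_const.sub (ContDiff.div_const ?_ _))
  exact (contDiff_id.sub contDiff_const).norm_sq ℝ

theorem obstacle_nonneg (z : Plane) (σ : ℝ) (y : Plane) : 0 ≤ obstacle z σ y := by
  rw [obstacle, bump_eq_expNegInvGlue]
  exact expNegInvGlue.nonneg _

theorem obstacle_eq_zero (hσ : 0 < σ) {y : Plane} (hy : σ ≤ ‖y - z‖) : obstacle z σ y = 0 := by
  rw [obstacle, bump, if_neg]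
  rw [not_lt, abs_div, abs_norm, abs_of_pos hσ]
  exact (one_le_div hσ).2 hy

theorem gradient_obstacle_contDiff (z : Plane) (σ : ℝ) : ContDiff ℝ ∞ (∇ (obstacle z σ)) :=
  (InnerProductSpace.toDual ℝ Plane).symm.contDiff.comp
    ((obstacle_contDiff z σ).fderiv_right le_rfl)

theorem continuous_curvatureBound (z : Plane) (σ : ℝ) : Continuous (curvatureBound z σ) := by
  have h1 := (gradient_obstacle_contDiff z σ).continuous
  have h2 := ((gradient_obstacle_contDiff z σ).fderiv_right (m := ∞) le_rfl).continuous
  unfold curvatureBound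
  fun_prop

theorem curvatureBound_nonneg (z : Plane) (σ : ℝ) (y : Plane) : 0 ≤ curvatureBound z σ y := by
  unfold curvatureBound
  positivity

theorem bddAbove_curvatureBound (z : Plane) (σ : ℝ) :
    BddAbove (curvatureBound z σ '' Metric.ball z σ) :=
  ((isCompact_closedBall z σ).bddAbove_image (continuous_curvatureBound z σ).continuousOn).mono
    (image_mono Metric.ball_subset_closedBall)

theorem curvatureBound_eq_zero (hσ : 0 < σ) {y : Plane} (hy : y ∉ Metric.closedBall z σ) :
    curvatureBound z σ y = 0 := by
  have hev : obstacle z σ =ᶠ[𝓝 y] fun _ => 0 := by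
    filter_upwards [Metric.isClosed_closedBall.isOpen_compl.mem_nhds hy] with x hx
    refine obstacle_eq_zero hσ ?_
    rw [mem_compl_iff, mem_closedBall_iff_norm, not_le] at hx
    exact hx.le
  have hgrad : ∇ (obstacle z σ) =ᶠ[𝓝 y] fun _ => 0 := by
    filter_upwards [hev.eventuallyEq_nhds] with x hx
    rw [gradient, hx.fderiv_eq]
    simp
  rw [curvatureBound, hgrad.self_of_nhds, hgrad.fderiv_eq]
  simp

/-- The bound passes from the open disc to its closure by continuity, and outside the closed disc
the profile vanishes locally. -/
theorem curvatureBound_le_sSup (hσ : 0 < σ) (y : Plane) :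
    curvatureBound z σ y ≤ sSup (curvatureBound z σ '' Metric.ball z σ) := by
  set S := sSup (curvatureBound z σ '' Metric.ball z σ) with hS
  have hball : ∀ x ∈ Metric.ball z σ, curvatureBound z σ x ≤ S := fun x hx =>
    le_csSup (bddAbove_curvatureBound z σ) (mem_image_of_mem _ hx)
  by_cases hy : y ∈ Metric.closedBall z σ
  · rw [← closure_ball z hσ.ne'] at hy
    exact closure_minimal hball (isClosed_le (continuous_curvatureBound z σ) continuous_const) hy
  · rw [curvatureBound_eq_zero hσ hy]
    exact (curvatureBound_nonneg z σ z).trans (hball z (Metric.mem_ball_self hσ))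

/-- The nonquadratic part of the running cost, for `γ = 1`. -/
noncomputable def obstacleCost (z : Plane) (σ : ℝ) (y : Plane) : ℝ :=
  1 / 2 * ‖y‖ ^ 2 * obstacle z σ y

theorem runningCost_eq (γ : ℝ) (z : Plane) (σ : ℝ) (y : Plane) :
    runningCost γ z σ y = 1 / 2 * ‖y‖ ^ 2 + γ * obstacleCost z σ y := by
  rw [runningCost, obstacleCost]
  ring

theorem obstacleCost_contDiff (z : Plane) (σ : ℝ) : ContDiff ℝ ∞ (obstacleCost z σ) :=
  (contDiff_const.mul (contDiff_id.norm_sq ℝ)).mul (obstacle_contDiff z σ)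

theorem obstacleCost_nonneg (z : Plane) (σ : ℝ) (y : Plane) : 0 ≤ obstacleCost z σ y :=
  mul_nonneg (by positivity) (obstacle_nonneg z σ y)

theorem obstacleCost_eq_zero (hσ : 0 < σ) {y : Plane} (hy : ‖y‖ ≤ ‖z‖ - σ) :
    obstacleCost z σ y = 0 := by
  rw [obstacleCost, obstacle_eq_zero hσ, mul_zero]
  have := norm_sub_norm_le z y
  rw [norm_sub_rev]
  linarith

/-- The obstacle cost becomes convex after adding a quadratic term. -/
theorem convexOn_obstacleCost_add {S : ℝ} (hS : ∀ y, curvatureBound z σ y ≤ S) :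
    ConvexOn ℝ univ fun y => obstacleCost z σ y + S / 2 * ‖y‖ ^ 2 := by
  refine convexOn_univ_of_forall_line fun a v => ?_
  set f := obstacle z σ with hf
  set g := ∇ f with hg
  have hline : ∀ s : ℝ, HasDerivAt (fun s : ℝ => a + s • v) v s := fun s => by
    simpa using ((hasDerivAt_id s).smul_const v).const_add a
  have hfd : ∀ s : ℝ, HasDerivAt (fun s : ℝ => f (a + s • v)) (inner ℝ (g (a + s • v)) v) s := by
    intro s
    have h1 : HasGradientAt f (g (a + s • v)) (a + s • v) :=
      ((obstacle_contDiff z σ).differentiable (by simp) _).hasGradientAt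
    have h2 := h1.hasFDerivAt.comp_hasDerivAt s (hline s)
    exact h2.congr_deriv (by simp)
  have hgd : ∀ s : ℝ, HasDerivAt (fun s : ℝ => inner ℝ (g (a + s • v)) v)
      (inner ℝ (fderiv ℝ g (a + s • v) v) v) s := by
    intro s
    have h1 := ((gradient_obstacle_contDiff z σ).differentiable (by simp) (a + s • v)).hasFDerivAt
    exact ((h1.comp_hasDerivAt s (hline s)).inner ℝ (hasDerivAt_const s v)).congr_deriv
      (by rw [inner_zero_right, zero_add])
  have hnd : ∀ s : ℝ, HasDerivAt (fun s : ℝ => ‖a + s • v‖ ^ 2) (2 * inner ℝ (a + s • v) v) s :=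
    fun s => (hline s).norm_sq
  have hid : ∀ s : ℝ, HasDerivAt (fun s : ℝ => inner ℝ (a + s • v) v) (‖v‖ ^ 2) s := by
    intro s
    simpa using (hline s).inner ℝ (hasDerivAt_const s v)
  have hd1 : ∀ s : ℝ, HasDerivAt
      (fun s : ℝ => obstacleCost z σ (a + s • v) + S / 2 * ‖a + s • v‖ ^ 2)
      (inner ℝ (a + s • v) v * f (a + s • v)
        + 1 / 2 * ‖a + s • v‖ ^ 2 * inner ℝ (g (a + s • v)) v + S * inner ℝ (a + s • v) v) s := by
    intro s
    refine ((((hnd s).const_mul (1 / 2)).mul (hfd s)).add ((hnd s).const_mul (S / 2))).congr_deriv ?_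
    ring
  have hd2 : ∀ s : ℝ, HasDerivAt
      (fun s : ℝ => inner ℝ (a + s • v) v * f (a + s • v)
        + 1 / 2 * ‖a + s • v‖ ^ 2 * inner ℝ (g (a + s • v)) v + S * inner ℝ (a + s • v) v)
      (‖v‖ ^ 2 * f (a + s • v) + 2 * (inner ℝ (a + s • v) v * inner ℝ (g (a + s • v)) v)
        + 1 / 2 * ‖a + s • v‖ ^ 2 * inner ℝ (fderiv ℝ g (a + s • v) v) v + S * ‖v‖ ^ 2) s := by
    intro s
    refine ((((hid s).mul (hfd s)).add
      (((hnd s).const_mul (1 / 2)).mul (hgd s))).add ((hid s).const_mul S)).congr_deriv ?_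
    ring
  have hderiv := funext fun s => (hd1 s).deriv
  refine convexOn_univ_of_deriv2_nonneg (fun s => (hd1 s).differentiableAt) ?_ fun s => ?_
  · rw [hderiv]
    exact fun s => (hd2 s).differentiableAt
  · rw [Function.iterate_succ_apply, Function.iterate_one, hderiv, (hd2 s).deriv]
    generalize a + s • v = y
    -- Of the three terms of the Hessian of the obstacle cost this one has a good sign; the other
    -- two are bounded together by `curvatureBound z σ y * ‖v‖ ^ 2`.
    have h1 : 0 ≤ ‖v‖ ^ 2 * f y := mul_nonneg (by positivity) (obstacle_nonneg z σ y)
    have h2 : |inner ℝ y v * inner ℝ (g y) v| ≤ (‖y‖ * ‖v‖) * (‖g y‖ * ‖v‖) := by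
      rw [abs_mul]
      gcongr <;> exact abs_real_inner_le_norm _ _
    have h3 : |inner ℝ (fderiv ℝ g y v) v| ≤ ‖fderiv ℝ g y‖ * ‖v‖ * ‖v‖ :=
      (abs_real_inner_le_norm _ _).trans (by gcongr; exact (fderiv ℝ g y).le_opNorm v)
    have h4 : 1 / 2 * ‖y‖ ^ 2 * -(‖fderiv ℝ g y‖ * ‖v‖ * ‖v‖)
        ≤ 1 / 2 * ‖y‖ ^ 2 * inner ℝ (fderiv ℝ g y v) v := by
      gcongr
      exact neg_le_of_abs_le h3
    have h5 : curvatureBound z σ y * ‖v‖ ^ 2 ≤ S * ‖v‖ ^ 2 := by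
      gcongr
      exact hS y
    rw [curvatureBound, ← hf, ← hg] at h5
    have h6 := neg_le_of_abs_le h2
    nlinarith

end ObstacleControl

/-! ### The Cauchy–Schwarz inequality for square integrable functions. -/

section SquareIntegrable

variable {α E : Type*} [MeasurableSpace α] {μ : Measure α} [NormedAddCommGroup E]

theorem MeasureTheory.MemLp.integrable_norm_sq {f : α → E} (hf : MemLp f 2 μ) :
    Integrable (fun t => ‖f t‖ ^ 2) μ :=
  (memLp_two_iff_integrable_sq_norm hf.1).1 hf

variable [InnerProductSpace ℝ E]

theorem MeasureTheory.L2.norm_sq_eq_integral (f : Lp E 2 μ) : ‖f‖ ^ 2 = ∫ t, ‖f t‖ ^ 2 ∂μ := by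
  rw [← real_inner_self_eq_norm_sq, L2.inner_def]
  simp only [real_inner_self_eq_norm_sq]

theorem MeasureTheory.MemLp.norm_integral_sq_le [CompleteSpace E] [IsFiniteMeasure μ] {f : α → E}
    (hf : MemLp f 2 μ) : ‖∫ t, f t ∂μ‖ ^ 2 ≤ μ.real univ * ∫ t, ‖f t‖ ^ 2 ∂μ := by
  set m := μ.real univ
  set I := ∫ t, f t ∂μ
  have hint : Integrable f μ := hf.integrable one_le_two
  have hm0 : 0 ≤ m := measureReal_nonneg
  -- The integral of this square is `m (m ∫ ‖f‖² - ‖I‖²)`, `m` times the wanted difference.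
  have hexp : ∀ t, ‖m • f t - I‖ ^ 2 = m ^ 2 * ‖f t‖ ^ 2 - 2 * m * inner ℝ I (f t) + ‖I‖ ^ 2 := by
    intro t
    rw [norm_sub_sq_real, norm_smul, inner_smul_left, real_inner_comm, mul_pow, Real.norm_eq_abs,
      sq_abs]
    simp
    ring
  have h0 : 0 ≤ ∫ t, ‖m • f t - I‖ ^ 2 ∂μ := integral_nonneg fun t => by positivity
  simp_rw [hexp] at h0
  have hi1 : Integrable (fun t => m ^ 2 * ‖f t‖ ^ 2) μ := hf.integrable_norm_sq.const_mul _
  have hi2 : Integrable (fun t => 2 * m * inner ℝ I (f t)) μ := (hint.const_inner I).const_mul _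
  have hi3 : Integrable (fun t => m ^ 2 * ‖f t‖ ^ 2 - 2 * m * inner ℝ I (f t)) μ := hi1.sub hi2
  rw [integral_add hi3 (integrable_const _), integral_sub hi1 hi2, integral_const_mul,
    integral_const_mul, integral_inner hint, integral_const, real_inner_self_eq_norm_sq,
    smul_eq_mul] at h0
  rcases hm0.eq_or_lt with hm | hm
  · have hμ : μ = 0 := by
      rw [← Measure.measure_univ_eq_zero]
      exact (measureReal_eq_zero_iff).1 hm.symm
    simp [I, hμ]
  · have : 0 ≤ m * (m * ∫ t, ‖f t‖ ^ 2 ∂μ - ‖I‖ ^ 2) := by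
      have : μ.real univ = m := rfl
      rw [this] at h0
      change 0 ≤ m ^ 2 * _ - 2 * m * ‖I‖ ^ 2 + _ at h0
      linarith
    have := nonneg_of_mul_nonneg_right this hm
    linarith

end SquareIntegrable

/-! ### The Sobolev space of perturbations on the half-line. -/

noncomputable section

namespace ObstacleControl

/-- Lebesgue measure on the half-line `(0, ∞)`. -/
abbrev halfLine : Measure ℝ := volume.restrict (Ioi (0 : ℝ))

/-- The Hilbert space `L²((0, ∞); ℝ²)`. -/
abbrev L2Plane : Type := Lp Plane 2 halfLine

instance isFiniteMeasure_halfLine_restrict_Ioc (s t : ℝ) :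
    IsFiniteMeasure (halfLine.restrict (Ioc s t)) :=
  isFiniteMeasure_restrict.2 (((Measure.restrict_apply_le _ _).trans_lt (by simp)).ne)

theorem halfLine_real_Ioc_le {s t : ℝ} (hst : s ≤ t) : halfLine.real (Ioc s t) ≤ t - s := by
  rw [← Real.volume_real_Ioc_of_le hst]
  exact ENNReal.toReal_mono (by simp) (Measure.restrict_apply_le _ _)

theorem intervalIntegrable_of_memLp {q : ℝ → Plane} (hq : MemLp q 2 halfLine) (s t : ℝ) :
    IntervalIntegrable q halfLine s t := by
  have : ∀ a b : ℝ, IntegrableOn q (Ioc a b) halfLine := fun a b =>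
    (hq.restrict (Ioc a b)).integrable one_le_two
  exact ⟨this _ _, this _ _⟩

theorem norm_intervalIntegral_sq_le {q : ℝ → Plane} (hq : MemLp q 2 halfLine) {s t : ℝ}
    (hst : s ≤ t) :
    ‖∫ r in s..t, q r ∂halfLine‖ ^ 2 ≤ (t - s) * ∫ r in Ioc s t, ‖q r‖ ^ 2 ∂halfLine := by
  rw [intervalIntegral.integral_of_le hst]
  refine (hq.restrict (Ioc s t)).norm_integral_sq_le.trans ?_
  gcongr
  rw [measureReal_restrict_apply_univ]
  exact halfLine_real_Ioc_le hst

theorem setIntegral_norm_sq_le (q : L2Plane) (A : Set ℝ) :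
    ∫ r in A, ‖q r‖ ^ 2 ∂halfLine ≤ ‖q‖ ^ 2 := by
  rw [L2.norm_sq_eq_integral]
  exact setIntegral_le_integral (Lp.memLp q).integrable_norm_sq
    (Filter.Eventually.of_forall fun t => by positivity)

/-- The primitive at time `t`, vanishing at time `0`, of a square integrable function. -/
def primitive (t : ℝ) : L2Plane →L[ℝ] Plane :=
  LinearMap.mkContinuous
    { toFun := fun q => ∫ r in (0 : ℝ)..t, q r ∂halfLine
      map_add' := fun q q' => by
        rw [← intervalIntegral.integral_add (intervalIntegrable_of_memLp (Lp.memLp q) _ _)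
          (intervalIntegrable_of_memLp (Lp.memLp q') _ _)]
        refine intervalIntegral.integral_congr_ae ?_
        filter_upwards [Lp.coeFn_add q q'] with r hr _
        simpa using hr
      map_smul' := fun c q => by
        rw [RingHom.id_apply, ← intervalIntegral.integral_smul]
        refine intervalIntegral.integral_congr_ae ?_
        filter_upwards [Lp.coeFn_smul c q] with r hr _
        simpa using hr }
    √|t| fun q => by
      refine abs_le_of_sq_le_sq' ?_ (by positivity) |>.2
      rw [mul_pow, Real.sq_sqrt (abs_nonneg t)]
      change ‖∫ r in (0 : ℝ)..t, q r ∂halfLine‖ ^ 2 ≤ _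
      rcases le_total 0 t with ht | ht
      · refine (norm_intervalIntegral_sq_le (Lp.memLp q) ht).trans ?_
        rw [sub_zero, abs_of_nonneg ht]
        gcongr
        exact setIntegral_norm_sq_le q _
      · rw [intervalIntegral.integral_symm, norm_neg]
        refine (norm_intervalIntegral_sq_le (Lp.memLp q) ht).trans ?_
        rw [zero_sub, abs_of_nonpos ht]
        gcongr
        · linarith
        · exact setIntegral_norm_sq_le q _

theorem primitive_apply (t : ℝ) (q : L2Plane) :
    primitive t q = ∫ r in (0 : ℝ)..t, q r ∂halfLine := rfl

theorem norm_primitive_sub_sq_le (q : L2Plane) {s t : ℝ} (hst : s ≤ t) :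
    ‖primitive t q - primitive s q‖ ^ 2 ≤ (t - s) * ∫ r in Ioc s t, ‖q r‖ ^ 2 ∂halfLine := by
  rw [primitive_apply, primitive_apply, intervalIntegral.integral_interval_sub_left
    (intervalIntegrable_of_memLp (Lp.memLp q) _ _) (intervalIntegrable_of_memLp (Lp.memLp q) _ _)]
  exact norm_intervalIntegral_sq_le (Lp.memLp q) hst

/-- Cauchy–Schwarz gives Hölder continuity of exponent `1/2` in operator norm, the norm in which the
parametric integral lemma needs continuity. -/
theorem continuous_primitive : Continuous primitive := by
  have hle : ∀ s t : ℝ, s ≤ t → ‖primitive t - primitive s‖ ≤ √|t - s| := fun s t hst => by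
    refine ContinuousLinearMap.opNorm_le_bound _ (by positivity) fun q => ?_
    refine abs_le_of_sq_le_sq' ?_ (by positivity) |>.2
    rw [mul_pow, Real.sq_sqrt (abs_nonneg _), abs_of_nonneg (sub_nonneg.2 hst)]
    refine (norm_primitive_sub_sq_le q hst).trans ?_
    have := sub_nonneg.2 hst
    gcongr
    exact setIntegral_norm_sq_le q _
  have hle' : ∀ s t : ℝ, dist (primitive t) (primitive s) ≤ √|t - s| := fun s t => by
    rw [dist_eq_norm]
    rcases le_total s t with h | h
    · exact hle s t h
    · rw [norm_sub_rev, abs_sub_comm]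
      exact hle t s h
  rw [continuous_iff_continuousAt]
  intro s
  refine tendsto_iff_dist_tendsto_zero.2 (squeeze_zero (fun _ => dist_nonneg) (hle' s) ?_)
  have : Continuous fun t : ℝ => √|t - s| := by fun_prop
  simpa using this.tendsto s

/-- The Hilbert space of pairs `(w, w')` with `w ∈ H¹((0, ∞); ℝ²)` and `w(0) = 0`. -/
def zeroTraceSobolev : Submodule ℝ (WithLp 2 (L2Plane × L2Plane)) where
  carrier := {x | x.fst =ᵐ[halfLine] fun t => primitive t x.snd}
  zero_mem' := by
    filter_upwards [Lp.coeFn_zero Plane 2 halfLine] with t ht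
    simpa using ht
  add_mem' := fun {x y} hx hy => by
    filter_upwards [hx, hy, Lp.coeFn_add x.fst y.fst] with t h1 h2 h3
    simpa [h1, h2] using h3
  smul_mem' := fun c x hx => by
    filter_upwards [hx, Lp.coeFn_smul c x.fst] with t h1 h2
    simpa [h1] using h2

/-- An `L²` limit is an a.e. limit along a subsequence, and `primitive t` is continuous on `L²` for
each `t`. -/
theorem isClosed_zeroTraceSobolev :
    IsClosed (zeroTraceSobolev : Set (WithLp 2 (L2Plane × L2Plane))) := by
  rw [← isSeqClosed_iff_isClosed]
  intro x a hx ha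
  have h1 : Filter.Tendsto (fun n => (x n).fst) Filter.atTop (𝓝 a.fst) :=
    ((WithLp.fstL 2 ℝ L2Plane L2Plane).continuous.tendsto a).comp ha
  have h2 : Filter.Tendsto (fun n => (x n).snd) Filter.atTop (𝓝 a.snd) :=
    ((WithLp.sndL 2 ℝ L2Plane L2Plane).continuous.tendsto a).comp ha
  obtain ⟨ns, hns, hlim⟩ := (tendstoInMeasure_of_tendsto_Lp h1).exists_seq_tendsto_ae
  have hall : ∀ᵐ t ∂halfLine, ∀ n, (x n).fst t = primitive t (x n).snd := ae_all_iff.2 hx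
  change a.fst =ᵐ[halfLine] fun t => primitive t a.snd
  filter_upwards [hlim, hall] with t ht hxt
  simp only [hxt] at ht
  exact tendsto_nhds_unique ht
    ((((primitive t).continuous.tendsto _).comp h2).comp hns.tendsto_atTop)

instance : CompleteSpace zeroTraceSobolev := isClosed_zeroTraceSobolev.completeSpace_coe

/-- The function component of an element of the Sobolev space. -/
def position : zeroTraceSobolev →L[ℝ] L2Plane :=
  (WithLp.fstL 2 ℝ L2Plane L2Plane).comp zeroTraceSobolev.subtypeL

/-- The derivative component of an element of the Sobolev space. -/
def velocity : zeroTraceSobolev →L[ℝ] L2Plane :=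
  (WithLp.sndL 2 ℝ L2Plane L2Plane).comp zeroTraceSobolev.subtypeL

theorem position_ae_eq (x : zeroTraceSobolev) :
    position x =ᵐ[halfLine] fun t => primitive t (velocity x) := x.2

theorem norm_sq_eq_position_add_velocity (x : zeroTraceSobolev) :
    ‖x‖ ^ 2 = ‖position x‖ ^ 2 + ‖velocity x‖ ^ 2 :=
  WithLp.prod_norm_sq_eq_of_L2 (x : WithLp 2 (L2Plane × L2Plane))

/-- Compare the value at `t` with that at each `r` in the unit window after `t`, then average over
`r`. This local bound yields both the uniform bound and the decay at infinity. -/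
theorem norm_primitive_velocity_sq_le (x : zeroTraceSobolev) {t : ℝ} (ht : 0 ≤ t) :
    ‖primitive t (velocity x)‖ ^ 2 ≤
      2 * ∫ r in Ioc t (t + 1), (‖position x r‖ ^ 2 + ‖velocity x r‖ ^ 2) ∂halfLine := by
  set ν := halfLine.restrict (Ioc t (t + 1)) with hν
  have : IsFiniteMeasure ν := isFiniteMeasure_halfLine_restrict_Ioc _ _
  have hν1 : ν = volume.restrict (Ioc t (t + 1)) := by
    rw [hν, Measure.restrict_restrict measurableSet_Ioc, inter_eq_left.2]
    exact fun r hr => ht.trans_lt hr.1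
  have hmass : ν.real univ = 1 := by
    rw [hν1, measureReal_restrict_apply_univ, Real.volume_real_Ioc_of_le (by linarith)]
    ring
  have hi1 : Integrable (fun r => ‖position x r‖ ^ 2) ν :=
    ((Lp.memLp (position x)).restrict _).integrable_norm_sq
  have hi2 : Integrable (fun r => ‖velocity x r‖ ^ 2) ν :=
    ((Lp.memLp (velocity x)).restrict _).integrable_norm_sq
  rw [integral_add hi1 hi2]
  set Q := ∫ r in Ioc t (t + 1), ‖velocity x r‖ ^ 2 ∂halfLine with hQ
  have hbound : ∀ᵐ r ∂ν, ‖primitive t (velocity x)‖ ^ 2 ≤ 2 * (‖position x r‖ ^ 2 + Q) := by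
    filter_upwards [ae_restrict_of_ae (s := Ioc t (t + 1)) (position_ae_eq x),
      ae_restrict_mem (μ := halfLine) (measurableSet_Ioc (a := t) (b := t + 1))] with r hr hmem
    have h1 := norm_primitive_sub_sq_le (velocity x) hmem.1.le
    have h2 : (r - t) * ∫ r in Ioc t r, ‖velocity x r‖ ^ 2 ∂halfLine ≤ 1 * Q := by
      have hle : ∫ r in Ioc t r, ‖velocity x r‖ ^ 2 ∂halfLine ≤ Q :=
        setIntegral_mono_set hi2 (Filter.Eventually.of_forall fun _ => by positivity)
          (Ioc_subset_Ioc_right hmem.2).eventuallyLE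
      have h0 : 0 ≤ ∫ r in Ioc t r, ‖velocity x r‖ ^ 2 ∂halfLine :=
        integral_nonneg fun _ => by positivity
      exact mul_le_mul (by linarith [hmem.2]) hle h0 zero_le_one
    rw [hr]
    have h3 : ‖primitive t (velocity x)‖ ≤
        ‖primitive r (velocity x)‖ + ‖primitive r (velocity x) - primitive t (velocity x)‖ := by
      have := norm_sub_le (primitive r (velocity x))
        (primitive r (velocity x) - primitive t (velocity x))
      rwa [sub_sub_cancel] at this
    have h4 := pow_le_pow_left₀ (norm_nonneg _) h3 2
    have h5 := add_sq_le (a := ‖primitive r (velocity x)‖)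
      (b := ‖primitive r (velocity x) - primitive t (velocity x)‖)
    linarith
  have h := integral_mono_ae (integrable_const _) ((hi1.add (integrable_const Q)).const_mul 2)
    hbound
  rw [integral_const, hmass, one_smul, integral_const_mul] at h
  simp only [Pi.add_apply] at h
  rwa [integral_add hi1 (integrable_const Q), integral_const, hmass, one_smul] at h

theorem norm_primitive_velocity_le (x : zeroTraceSobolev) {t : ℝ} (ht : 0 ≤ t) :
    ‖primitive t (velocity x)‖ ≤ 2 * ‖x‖ := by
  refine abs_le_of_sq_le_sq' ?_ (by positivity) |>.2
  refine (norm_primitive_velocity_sq_le x ht).trans ?_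
  rw [integral_add ((Lp.memLp (position x)).restrict _).integrable_norm_sq
    ((Lp.memLp (velocity x)).restrict _).integrable_norm_sq, mul_pow,
    norm_sq_eq_position_add_velocity]
  have h1 := setIntegral_norm_sq_le (position x) (Ioc t (t + 1))
  have h2 := setIntegral_norm_sq_le (velocity x) (Ioc t (t + 1))
  nlinarith [sq_nonneg ‖position x‖, sq_nonneg ‖velocity x‖]

/-- The integral of an integrable function over the window `(t, t + 1]` tends to `0`. -/
theorem tendsto_primitive_velocity (x : zeroTraceSobolev) :
    Filter.Tendsto (fun t => primitive t (velocity x)) Filter.atTop (𝓝 0) := by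
  set f : ℝ → ℝ := fun r => ‖position x r‖ ^ 2 + ‖velocity x r‖ ^ 2 with hf
  have hfi : Integrable f halfLine :=
    (Lp.memLp (position x)).integrable_norm_sq.add (Lp.memLp (velocity x)).integrable_norm_sq
  have hlim : Filter.Tendsto (fun t => ∫ r in (0 : ℝ)..t, f r ∂halfLine) Filter.atTop
      (𝓝 (∫ r in Ioi (0 : ℝ), f r ∂halfLine)) :=
    intervalIntegral_tendsto_integral_Ioi 0 hfi.integrableOn Filter.tendsto_id
  have hlim2 := (((hlim.comp (Filter.tendsto_atTop_add_const_right _ 1 Filter.tendsto_id)).sub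
    hlim).const_mul 2)
  rw [sub_self, mul_zero] at hlim2
  have hsq : Filter.Tendsto (fun t => ‖primitive t (velocity x)‖ ^ 2) Filter.atTop (𝓝 0) := by
    refine squeeze_zero' (Filter.Eventually.of_forall fun _ => by positivity) ?_ hlim2
    filter_upwards [Filter.eventually_ge_atTop 0] with t ht
    refine (norm_primitive_velocity_sq_le x ht).trans_eq ?_
    simp only [Function.comp_apply, id_eq]
    rw [intervalIntegral.integral_interval_sub_left hfi.intervalIntegrable hfi.intervalIntegrable,
      intervalIntegral.integral_of_le (by linarith)]
  rw [tendsto_zero_iff_norm_tendsto_zero]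
  simpa using hsq.sqrt

end ObstacleControl

end

/-! ### The reduced cost: smoothness, strong convexity, agreement with the objective. -/

noncomputable section

namespace ObstacleControl

variable {z : Plane} {σ : ℝ}

theorem memLp_exp_neg_smul (p : Plane) : MemLp (fun t : ℝ => Real.exp (-t) • p) 2 halfLine := by
  rw [memLp_two_iff_integrable_sq_norm (by fun_prop)]
  have h : IntegrableOn (fun t : ℝ => Real.exp (-2 * t) * ‖p‖ ^ 2) (Ioi 0) :=
    (exp_neg_integrableOn_Ioi 0 two_pos).mul_const _
  refine h.congr (Filter.Eventually.of_forall fun t => ?_)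
  simp only [norm_smul, Real.norm_eq_abs, Real.abs_exp, mul_pow, ← Real.exp_nat_mul]
  push_cast
  ring_nf

/-- The function `t ↦ e⁻ᵗ p` as an element of `L²`, depending linearly on `p`. -/
def expLift : Plane →L[ℝ] L2Plane :=
  LinearMap.toContinuousLinearMap
    { toFun := fun p => (memLp_exp_neg_smul p).toLp
      map_add' := fun p p' => by
        rw [← MemLp.toLp_add]
        congr 1
        ext1 t
        simp [smul_add]
      map_smul' := fun c p => by
        rw [RingHom.id_apply, ← MemLp.toLp_const_smul]
        congr 1
        ext1 t
        exact smul_comm _ _ _ }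

theorem expLift_ae_eq (p : Plane) : expLift p =ᵐ[halfLine] fun t => Real.exp (-t) • p :=
  (memLp_exp_neg_smul p).coeFn_toLp

/-- The state at time `t`, as a function of the initial state `p` and of the perturbation `x` of the
reference trajectory `t ↦ e⁻ᵗ p`. -/
def state (t : ℝ) : Plane × zeroTraceSobolev →L[ℝ] Plane :=
  Real.exp (-t) • ContinuousLinearMap.fst ℝ Plane zeroTraceSobolev +
    ((primitive t).comp velocity).comp (ContinuousLinearMap.snd ℝ Plane zeroTraceSobolev)

theorem state_apply (t : ℝ) (p : Plane) (x : zeroTraceSobolev) :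
    state t (p, x) = Real.exp (-t) • p + primitive t (velocity x) := rfl

theorem continuous_state : Continuous state := by
  have := continuous_primitive
  unfold state
  fun_prop

theorem state_ae_eq (p : Plane) (x : zeroTraceSobolev) :
    (fun t => state t (p, x)) =ᵐ[halfLine] (expLift p + position x : L2Plane) := by
  filter_upwards [Lp.coeFn_add (expLift p) (position x), expLift_ae_eq p, position_ae_eq x]
    with t h1 h2 h3
  rw [h1, Pi.add_apply, h2, h3, state_apply]

theorem norm_state_le (ξ : Plane × zeroTraceSobolev) {t : ℝ} (ht : 0 ≤ t) :
    ‖state t ξ‖ ≤ 3 * ‖ξ‖ := by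
  obtain ⟨p, x⟩ := ξ
  have h1 : ‖Real.exp (-t) • p‖ ≤ 1 * ‖p‖ := by
    rw [norm_smul, Real.norm_eq_abs, Real.abs_exp]
    gcongr
    exact Real.exp_le_one_iff.2 (by linarith)
  have h2 := norm_primitive_velocity_le x ht
  have h3 : ‖p‖ ≤ ‖(p, x)‖ := norm_fst_le (p, x)
  have h4 : ‖x‖ ≤ ‖(p, x)‖ := norm_snd_le (p, x)
  rw [state_apply]
  refine (norm_add_le _ _).trans ?_
  linarith

theorem tendsto_state (ξ : Plane × zeroTraceSobolev) :
    Filter.Tendsto (fun t => state t ξ) Filter.atTop (𝓝 0) := by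
  have h1 : Filter.Tendsto (fun t : ℝ => Real.exp (-t) • ξ.1) Filter.atTop (𝓝 ((0 : ℝ) • ξ.1)) :=
    Real.tendsto_exp_neg_atTop_nhds_zero.smul_const _
  have h2 := h1.add (tendsto_primitive_velocity ξ.2)
  rwa [zero_smul, add_zero] at h2

/-- Near a given point of the parameter space, the trajectories avoid the obstacle after a common
finite time. -/
theorem eventually_obstacleCost_state_eq_zero (hσ : 0 < σ) (hz : σ < ‖z‖)
    (ξ : Plane × zeroTraceSobolev) :
    ∃ T : ℝ, 0 ≤ T ∧ ∀ᶠ ξ' in 𝓝 ξ, ∀ t, T ≤ t → obstacleCost z σ (state t ξ') = 0 := by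
  set r := ‖z‖ - σ with hr
  have hr0 : 0 < r := sub_pos.2 hz
  have h1 : ∀ᶠ t in Filter.atTop, ‖state t ξ‖ < r / 2 := by
    have := (tendsto_state ξ).norm
    rw [norm_zero] at this
    exact this.eventually_lt_const (half_pos hr0)
  obtain ⟨T, hT⟩ := Filter.eventually_atTop.1 (h1.and (Filter.eventually_ge_atTop 0))
  refine ⟨T, (hT T le_rfl).2, ?_⟩
  -- By `norm_state_le`, radius `r / 6` moves the state by less than `r / 2` at every nonnegative
  -- time.
  filter_upwards [Metric.ball_mem_nhds ξ (show 0 < r / 6 by positivity)] with ξ' hξ' t ht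
  refine obstacleCost_eq_zero hσ ?_
  have h2 := norm_state_le (ξ' - ξ) (hT t ht).2
  have h3 := norm_le_norm_add_norm_sub (state t ξ) (state t ξ')
  rw [norm_sub_rev, ← map_sub] at h3
  rw [mem_ball_iff_norm] at hξ'
  linarith [(hT t ht).1]

/-- The integral of the obstacle cost along the trajectory. -/
def obstacleIntegral (z : Plane) (σ : ℝ) (ξ : Plane × zeroTraceSobolev) : ℝ :=
  ∫ t, obstacleCost z σ (state t ξ) ∂halfLine

theorem continuous_obstacleCost_state (z : Plane) (σ : ℝ) (ξ : Plane × zeroTraceSobolev) :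
    Continuous fun t => obstacleCost z σ (state t ξ) :=
  (obstacleCost_contDiff z σ).continuous.comp (by have := continuous_state; fun_prop)

theorem integrable_obstacleCost_state (hσ : 0 < σ) (hz : σ < ‖z‖) (ξ : Plane × zeroTraceSobolev) :
    Integrable (fun t => obstacleCost z σ (state t ξ)) halfLine := by
  obtain ⟨T, hT, hev⟩ := eventually_obstacleCost_state_eq_zero hσ hz ξ
  have h1 : IntegrableOn (fun t => obstacleCost z σ (state t ξ)) (Ioc 0 T) :=
    (continuous_obstacleCost_state z σ ξ).integrableOn_Ioc
  refine IntegrableOn.of_forall_sdiff_eq_zero h1 measurableSet_Ioi fun t ht => ?_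
  have : ¬ t ≤ T := fun h => ht.2 ⟨ht.1, h⟩
  exact hev.self_of_nhds t (by linarith)

theorem contDiff_obstacleIntegral (hσ : 0 < σ) (hz : σ < ‖z‖) :
    ContDiff ℝ ∞ (obstacleIntegral z σ) := by
  rw [contDiff_iff_contDiffAt]
  intro ξ
  obtain ⟨T, hT, hev⟩ := eventually_obstacleCost_state_eq_zero hσ hz ξ
  refine (contDiff_integral_comp_clm continuous_state T
    (obstacleCost_contDiff z σ)).contDiffAt.congr_of_eventuallyEq ?_
  filter_upwards [hev] with ξ' hξ'
  rw [obstacleIntegral, intervalIntegral.integral_of_le hT]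
  refine setIntegral_eq_of_subset_of_forall_sdiff_eq_zero measurableSet_Ioi Ioc_subset_Ioi_self
    fun t ht => ?_
  have : ¬ t ≤ T := fun h => ht.2 ⟨ht.1, h⟩
  exact hξ' t (by linarith)

/-- The objective, as a function of the initial state and of the perturbation of the reference
trajectory. -/
def reducedCost (γ β : ℝ) (z : Plane) (σ : ℝ) (ξ : Plane × zeroTraceSobolev) : ℝ :=
  1 / 2 * ‖expLift ξ.1 + position ξ.2‖ ^ 2 + β / 2 * ‖velocity ξ.2 - expLift ξ.1‖ ^ 2 +
    γ * obstacleIntegral z σ ξ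

theorem contDiff_reducedCost (γ β : ℝ) (hσ : 0 < σ) (hz : σ < ‖z‖) :
    ContDiff ℝ ∞ (reducedCost γ β z σ) := by
  have h1 := contDiff_obstacleIntegral hσ hz
  have h2 : ContDiff ℝ ∞ fun ξ : Plane × zeroTraceSobolev => expLift ξ.1 + position ξ.2 := by
    fun_prop
  have h3 : ContDiff ℝ ∞ fun ξ : Plane × zeroTraceSobolev => velocity ξ.2 - expLift ξ.1 := by
    fun_prop
  exact ((contDiff_const.mul (h2.norm_sq ℝ)).add (contDiff_const.mul (h3.norm_sq ℝ))).add
    (contDiff_const.mul h1)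

theorem reducedCost_nonneg {γ β : ℝ} (hγ : 0 ≤ γ) (hβ : 0 < β) (ξ : Plane × zeroTraceSobolev) :
    0 ≤ reducedCost γ β z σ ξ := by
  have : 0 ≤ obstacleIntegral z σ ξ := integral_nonneg fun t => obstacleCost_nonneg z σ _
  unfold reducedCost
  positivity

theorem norm_sq_convexCombination {E : Type*} [NormedAddCommGroup E] [InnerProductSpace ℝ E]
    (x y : E) {a b : ℝ} (hab : a + b = 1) :
    ‖a • x + b • y‖ ^ 2 = a * ‖x‖ ^ 2 + b * ‖y‖ ^ 2 - a * b * ‖x - y‖ ^ 2 := by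
  rw [norm_add_sq_real, norm_sub_sq_real, norm_smul, norm_smul, inner_smul_left, inner_smul_right,
    mul_pow, mul_pow, Real.norm_eq_abs, Real.norm_eq_abs, sq_abs, sq_abs]
  obtain rfl : b = 1 - a := by linarith
  simp
  ring

/-- This is pointwise semiconvexity integrated in time. The reference path cancels in the difference
of two states, so the convexity defect is an `L²` norm of positions. -/
theorem obstacleIntegral_convexCombination_le (hσ : 0 < σ) (hz : σ < ‖z‖) {S : ℝ}
    (hS : ∀ y, curvatureBound z σ y ≤ S) (p : Plane) (x y : zeroTraceSobolev) {a b : ℝ}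
    (ha : 0 ≤ a) (hb : 0 ≤ b) (hab : a + b = 1) :
    obstacleIntegral z σ (p, a • x + b • y) ≤
      a * obstacleIntegral z σ (p, x) + b * obstacleIntegral z σ (p, y) +
        S / 2 * (a * b * ‖position x - position y‖ ^ 2) := by
  have hint := integrable_obstacleCost_state hσ hz
  have hpt : ∀ᵐ t ∂halfLine, obstacleCost z σ (state t (p, a • x + b • y)) ≤
      a * obstacleCost z σ (state t (p, x)) + b * obstacleCost z σ (state t (p, y)) +
        S / 2 * (a * b * ‖(position x - position y : L2Plane) t‖ ^ 2) := by
    filter_upwards [position_ae_eq x, position_ae_eq y,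
      Lp.coeFn_sub (position x) (position y)] with t h1 h2 h3
    have hst : state t (p, a • x + b • y) = a • state t (p, x) + b • state t (p, y) := by
      rw [← map_smul, ← map_smul, ← map_add]
      congr 1
      simp [← add_smul, hab]
    have hdiff : (position x - position y : L2Plane) t = state t (p, x) - state t (p, y) := by
      rw [h3, Pi.sub_apply, h1, h2, state_apply, state_apply]
      abel
    have h := (convexOn_obstacleCost_add hS).2 (mem_univ (state t (p, x)))
      (mem_univ (state t (p, y))) ha hb hab
    simp only [smul_eq_mul, norm_sq_convexCombination _ _ hab] at h
    rw [hst, hdiff]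
    linarith
  have hi1 := (hint (p, x)).const_mul a
  have hi2 := (hint (p, y)).const_mul b
  have hi3 : Integrable (fun t => S / 2 * (a * b * ‖(position x - position y : L2Plane) t‖ ^ 2))
      halfLine := ((Lp.memLp (position x - position y)).integrable_norm_sq.const_mul _).const_mul _
  have hi12 : Integrable (fun t => a * obstacleCost z σ (state t (p, x)) +
      b * obstacleCost z σ (state t (p, y))) halfLine := hi1.add hi2
  refine (integral_mono_ae (hint _) (hi12.add hi3) hpt).trans_eq ?_
  simp only [Pi.add_apply]
  rw [integral_add hi12 hi3, integral_add hi1 hi2, integral_const_mul, integral_const_mul,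
    integral_const_mul, integral_const_mul, L2.norm_sq_eq_integral]
  rfl

/-- The position part has modulus `1`, of which the obstacle consumes at most `γ S`; the velocity
part has modulus `β`. The squared norm is the sum of both parts, hence the minimum. -/
theorem strongConvexOn_reducedCost (hσ : 0 < σ) (hz : σ < ‖z‖) {γ β S : ℝ} (hγ : 0 ≤ γ)
    (hS : ∀ y, curvatureBound z σ y ≤ S) (p : Plane) :
    StrongConvexOn univ (min (1 - γ * S) β) fun x => reducedCost γ β z σ (p, x) := by
  refine ⟨convex_univ, fun x _ y _ a b ha hb hab => ?_⟩
  have h1 : expLift p + position (a • x + b • y) =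
      a • (expLift p + position x) + b • (expLift p + position y) := by
    have : expLift p = a • expLift p + b • expLift p := by rw [← add_smul, hab, one_smul]
    rw [map_add, map_smul, map_smul]
    nth_rw 1 [this]
    module
  have h2 : velocity (a • x + b • y) - expLift p =
      a • (velocity x - expLift p) + b • (velocity y - expLift p) := by
    have : expLift p = a • expLift p + b • expLift p := by rw [← add_smul, hab, one_smul]
    rw [map_add, map_smul, map_smul]
    nth_rw 1 [this]
    module
  have h3 := mul_le_mul_of_nonneg_left
    (obstacleIntegral_convexCombination_le hσ hz hS p x y ha hb hab) hγ
  have h4 := norm_sq_eq_position_add_velocity (x - y)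
  rw [map_sub, map_sub] at h4
  have h5 : min (1 - γ * S) β * ‖position x - position y‖ ^ 2 ≤
      (1 - γ * S) * ‖position x - position y‖ ^ 2 := by
    gcongr
    exact min_le_left _ _
  have h6 : min (1 - γ * S) β * ‖velocity x - velocity y‖ ^ 2 ≤
      β * ‖velocity x - velocity y‖ ^ 2 := by
    gcongr
    exact min_le_right _ _
  have h7 := mul_le_mul_of_nonneg_left (add_le_add h5 h6) (mul_nonneg ha hb)
  simp only [reducedCost, h1, h2, h4, norm_sq_convexCombination _ _ hab, smul_eq_mul,
    add_sub_add_left_eq_sub, sub_sub_sub_cancel_right]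
  linarith

theorem trajectory_eq {p : Plane} {u : ℝ → Plane} {q : L2Plane}
    (hu : u =ᵐ[halfLine] (q - expLift p : L2Plane)) {t : ℝ} (ht : 0 ≤ t) :
    trajectory p u t = Real.exp (-t) • p + primitive t q := by
  have hrestr : halfLine.restrict (Ioc 0 t) = volume.restrict (Ioc 0 t) := by
    rw [Measure.restrict_restrict measurableSet_Ioc, inter_eq_left.2]
    exact fun r hr => hr.1
  have h1 : ∫ s in (0 : ℝ)..t, u s = ∫ s in (0 : ℝ)..t, (q s - Real.exp (-s) • p) ∂halfLine := by
    rw [intervalIntegral.integral_of_le ht, intervalIntegral.integral_of_le ht, ← hrestr]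
    refine integral_congr_ae (ae_restrict_of_ae ?_)
    filter_upwards [hu, Lp.coeFn_sub q (expLift p), expLift_ae_eq p] with s h1 h2 h3
    rw [h1, h2, Pi.sub_apply, h3]
  have h2 : ∫ s in (0 : ℝ)..t, Real.exp (-s) • p ∂halfLine = (1 - Real.exp (-t)) • p := by
    rw [intervalIntegral.integral_of_le ht, hrestr, ← intervalIntegral.integral_of_le ht,
      intervalIntegral.integral_smul_const, intervalIntegral.integral_comp_neg, integral_exp]
    simp
  rw [trajectory, h1, intervalIntegral.integral_sub (intervalIntegrable_of_memLp (Lp.memLp q) _ _)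
    (intervalIntegrable_of_memLp (memLp_exp_neg_smul p) _ _), h2, primitive_apply]
  module

theorem lintegral_ofReal_norm_sq (f : L2Plane) :
    ∫⁻ t, ENNReal.ofReal (‖f t‖ ^ 2) ∂halfLine = ENNReal.ofReal (‖f‖ ^ 2) := by
  rw [L2.norm_sq_eq_integral, ofReal_integral_eq_lintegral_ofReal
    (Lp.memLp f).integrable_norm_sq (Filter.Eventually.of_forall fun _ => by positivity)]

/-- The objective agrees with the reduced cost. -/
theorem cost_eq_reducedCost (hσ : 0 < σ) (hz : σ < ‖z‖) {γ β : ℝ} (hγ : 0 ≤ γ) (hβ : 0 < β)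
    {p : Plane} {x : zeroTraceSobolev} {u : ℝ → Plane}
    (hu : u =ᵐ[halfLine] (velocity x - expLift p : L2Plane)) :
    cost γ β z σ p u = ENNReal.ofReal (reducedCost γ β z σ (p, x)) := by
  have h1 : ∫⁻ t, ENNReal.ofReal (runningCost γ z σ (trajectory p u t)) ∂halfLine =
      ENNReal.ofReal (1 / 2 * ‖expLift p + position x‖ ^ 2 + γ * obstacleIntegral z σ (p, x)) := by
    have hi1 := (Lp.memLp (expLift p + position x)).integrable_norm_sq.const_mul (1 / 2)
    have hi2 := (integrable_obstacleCost_state hσ hz (p, x)).const_mul γ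
    have hi12 : Integrable (fun t => 1 / 2 * ‖(expLift p + position x : L2Plane) t‖ ^ 2 +
        γ * obstacleCost z σ (state t (p, x))) halfLine := hi1.add hi2
    rw [L2.norm_sq_eq_integral, obstacleIntegral, ← integral_const_mul, ← integral_const_mul,
      ← integral_add hi1 hi2, ofReal_integral_eq_lintegral_ofReal hi12
      (Filter.Eventually.of_forall fun t => add_nonneg (by positivity)
        (mul_nonneg hγ (obstacleCost_nonneg z σ _)))]
    refine lintegral_congr_ae ?_
    filter_upwards [state_ae_eq p x, ae_restrict_mem measurableSet_Ioi] with t ht hmem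
    rw [← ht, trajectory_eq hu (le_of_lt hmem), ← state_apply, runningCost_eq]
  have h2 : ∫⁻ t, ENNReal.ofReal (‖u t‖ ^ 2) ∂halfLine =
      ENNReal.ofReal (‖velocity x - expLift p‖ ^ 2) := by
    rw [← lintegral_ofReal_norm_sq]
    refine lintegral_congr_ae ?_
    filter_upwards [hu] with t ht
    rw [ht]
  have h3 : 0 ≤ obstacleIntegral z σ (p, x) := integral_nonneg fun t => obstacleCost_nonneg z σ _
  rw [cost, h1, h2, ← ENNReal.ofReal_mul (by positivity), ← ENNReal.ofReal_add (by positivity)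
    (by positivity), reducedCost]
  congr 1
  ring

/-- Every control of finite cost is represented in the Sobolev space. -/
theorem exists_velocity_of_cost_ne_top {γ β : ℝ} (hγ : 0 ≤ γ) {p : Plane} {u : ℝ → Plane}
    (hu : Admissible u) (hcost : cost γ β z σ p u ≠ ⊤) :
    ∃ x : zeroTraceSobolev, u =ᵐ[halfLine] (velocity x - expLift p : L2Plane) := by
  set q : L2Plane := hu.toLp + expLift p with hq
  have huq : u =ᵐ[halfLine] (q - expLift p : L2Plane) := by
    rw [hq, add_sub_cancel_right]
    exact hu.coeFn_toLp.symm
  set y : ℝ → Plane := fun t => Real.exp (-t) • p + primitive t q with hy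
  have hyc : Continuous y := by
    have := continuous_primitive
    fun_prop
  -- Finite cost thus puts `y` in `L²`, so `y` minus the reference path is an `L²` function with
  -- `L²` derivative `q`.
  have hle : ∫⁻ t, ENNReal.ofReal (1 / 2 * ‖y t‖ ^ 2) ∂halfLine ≤ cost γ β z σ p u := by
    refine le_trans (lintegral_mono_ae ?_) le_self_add
    filter_upwards [ae_restrict_mem measurableSet_Ioi] with t ht
    rw [trajectory_eq huq (le_of_lt ht), runningCost_eq]
    exact ENNReal.ofReal_le_ofReal
      (le_add_of_nonneg_right (mul_nonneg hγ (obstacleCost_nonneg z σ _)))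
  have hyL : MemLp y 2 halfLine := by
    rw [memLp_two_iff_integrable_sq_norm hyc.aestronglyMeasurable]
    have h1 : Integrable (fun t => 1 / 2 * ‖y t‖ ^ 2) halfLine :=
      (lintegral_ofReal_ne_top_iff_integrable (by fun_prop)
        (Filter.Eventually.of_forall fun t => by positivity)).1 (hle.trans_lt hcost.lt_top).ne
    refine (h1.const_mul 2).congr (Filter.Eventually.of_forall fun t => ?_)
    ring
  refine ⟨⟨WithLp.toLp 2 (hyL.toLp - expLift p, q), ?_⟩, huq⟩
  change (hyL.toLp - expLift p : L2Plane) =ᵐ[halfLine] fun t => primitive t q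
  filter_upwards [Lp.coeFn_sub hyL.toLp (expLift p), hyL.coeFn_toLp, expLift_ae_eq p]
    with t h1 h2 h3
  rw [h1, Pi.sub_apply, h2, h3, hy, add_sub_cancel_left]

end ObstacleControl

end

/-- For every initial state the minimum is finite and attained (so that the value function is a
real-valued minimum), and the value function is of class `C^∞` on the plane. -/
theorem proposition5p1 (β σ γ : ℝ) (z : ObstacleControl.Plane)
    (hβ : 0 < β) (hσ : 0 < σ) (hz₁ : z 0 < -σ) (hz₂ : z 1 = 0)
    (hγ₀ : 0 ≤ γ) (hγ : γ < ObstacleControl.gammaThreshold z σ) :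
    (∀ y₀ : ObstacleControl.Plane, ∃ u : ℝ → ObstacleControl.Plane,
      ObstacleControl.Admissible u ∧
        ObstacleControl.cost γ β z σ y₀ u =
          ENNReal.ofReal (ObstacleControl.valueFunction γ β z σ y₀)) ∧
      ContDiff ℝ ∞ (ObstacleControl.valueFunction γ β z σ) := by
  open ObstacleControl in
  have hz : σ < ‖z‖ := by
    have h1 : ‖z 0‖ ≤ ‖z‖ := PiLp.norm_apply_le z 0
    rw [Real.norm_eq_abs] at h1
    linarith [neg_le_abs (z 0)]
  set S := sSup (curvatureBound z σ '' Metric.ball z σ) with hS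
  have hγ' : γ < 1 / S := hγ
  -- Since `1 / 0 = 0`, the hypotheses on `γ` exclude a vanishing supremum.
  have hS0 : 0 < S := one_div_pos.1 (hγ₀.trans_lt hγ')
  have hγS : 0 < 1 - γ * S := sub_pos.2 ((lt_div_iff₀ hS0).1 hγ')
  obtain ⟨w, hmin, hsmooth⟩ := exists_minimizer_contDiff_of_strongConvexOn (lt_min hγS hβ)
    (contDiff_reducedCost γ β hσ hz)
    (strongConvexOn_reducedCost hσ hz hγ₀ (curvatureBound_le_sSup hσ))
    (fun p => ⟨0, forall_mem_range.2 fun x => reducedCost_nonneg hγ₀ hβ (p, x)⟩)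
  have hcost : ∀ p, Admissible (velocity (w p) - expLift p : L2Plane) ∧
      cost γ β z σ p (velocity (w p) - expLift p : L2Plane) =
        ENNReal.ofReal (reducedCost γ β z σ (p, w p)) := fun p =>
    ⟨Lp.memLp _, cost_eq_reducedCost hσ hz hγ₀ hβ (ae_eq_refl _)⟩
  have hval : valueFunction γ β z σ = fun p => reducedCost γ β z σ (p, w p) := by
    ext p
    have : (⨅ u : {u : ℝ → Plane // Admissible u}, cost γ β z σ p u.1) =
        ENNReal.ofReal (reducedCost γ β z σ (p, w p)) := by
      refine le_antisymm (iInf_le_of_le ⟨_, (hcost p).1⟩ (hcost p).2.le) (le_iInf fun u => ?_)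
      -- Controls of infinite cost have no representative in the Sobolev space, but cannot lower the
      -- infimum.
      by_cases htop : cost γ β z σ p u.1 = ⊤
      · rw [htop]
        exact le_top
      · obtain ⟨x, hx⟩ := exists_velocity_of_cost_ne_top hγ₀ u.2 htop
        rw [cost_eq_reducedCost hσ hz hγ₀ hβ hx]
        exact ENNReal.ofReal_le_ofReal (hmin p x)
    rw [valueFunction, this, ENNReal.toReal_ofReal (reducedCost_nonneg hγ₀ hβ _)]
  refine ⟨fun p => ⟨_, (hcost p).1, ?_⟩, ?_⟩
  · rw [(hcost p).2, hval]
  · rw [hval]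
    exact hsmooth
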